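/- Let $R$ be a commutative Noetherian local ring with maximal ideal $\mathfrak m$, and assume that $R$ is Gorenstein, i.e. $R$ has finite injective dimension as an $R$-module. Complexes are $\mathbb Z$-indexed with differentials $\partial_i\colon X_i\to X_{i-1}$. Definitions. A finitely generated $R$-module $G$ is *totally reflexive* if the biduality map $G\to G^{**}$ is an isomorphism and $\operatorname{Ext}^i_R(G,R)=0=\operatorname{Ext}^i_R(G^*,R)$ for all $i\ge 1$, where $G^*=\operatorname{Hom}_R(G,R)$. An acyclic complex $T$ of projective $R$-modules is *totally acyclic* if $\operatorname{Hom}_R(T,Q)$ is acyclic for every projective $R$-module $Q$. A *complete projective resolution* of an $R$-module $M$ is a totally acyclic complex $T$ of projective $R$-modules with $\operatorname{Coker}(T_1\to T_0)\cong M$; the Tate homology of $M$ with coefficients in an $R$-module $N$ is then $\widehat{\operatorname{Tor}}_i^R(M,N)=H_i(T\otimes_R N)$. A complex $F$ is *minimal* if it consists of finitely generated free modules and $\partial(F)\subseteq\mathfrak m F$. The *pinched tensor product* $T\boxtimes T'$ of two $R$-complexes is the complex with $$(T\boxtimes T')_n=\bigoplus_{\substack{i+j=n\\ i,j\ge 0}}T_i\otimes_R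 T'_j\quad (n\ge 0),\qquad (T\boxtimes T')_n=\bigoplus_{\substack{i+j+1=n\\ i,j\le -1}}T_i\otimes_R T'_j\quad (n\le -1),$$ and the following differential. On $x\otimes y\in T_i\otimes T'_j$ it is $\partial x\otimes y+(-1)^i x\otimes\partial y$ in degrees $n\ge 1$ (a term lying in $T_k\otimes T'_l$ with $k<0$ or $l<0$ is omitted), $\partial x\otimes \partial y\in T_{-1}\otimes T'_{-1}$ in degree $n=0$, and $\partial x\otimes y-(-1)^{i}x\otimes\partial y$ in degrees $n\le -1$. Statement. Let $M$ and $N$ be totally reflexive $R$-modules with complete projective resolutions $T$ and $T'$, respectively. If $\widehat{\operatorname{Tor}}{}^R_i(M,N)=0$ for all $i\in\mathbb Z$, then $M\otimes_R N$ is totally reflexive, and $T\boxtimes T'$ is a complete projective resolution of $M\otimes_R N$. If $T$ and $T'$ consist of finitely generated modules, then so does $T\boxtimes T'$; and if $T$ and $T'$ are minimal, then $T\boxtimes T'$ is minimal. -/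

import Mathlib

open CategoryTheory TensorProduct DirectSum

universe u

noncomputable section

variable {R : Type u} [CommRing R]

/-- A (Noetherian local) ring is Gorenstein if it has finite injective dimension as a module over
itself. -/
def IsGorensteinLocal (R : Type u) [CommRing R] [IsLocalRing R] [IsNoetherianRing R] : Prop :=
  ∃ n : ℕ, HasInjectiveDimensionLE (ModuleCat.of R R) n

/-- `G` is totally reflexive: it is finitely generated, the biduality map `G → G**` is an
isomorphism, and `Ext^i(G, R) = 0 = Ext^i(G*, R)` for all `i ≥ 1`. -/
structure IsTotallyReflexive (R : Type u) [CommRing R] (G : Type u) [AddCommGroup G]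
    [Module R G] : Prop where
  finite : Module.Finite R G
  reflexive : Module.IsReflexive R G
  ext_eq_zero : ∀ i : ℕ, 1 ≤ i →
    Subsingleton (Abelian.Ext.{u} (ModuleCat.of R G) (ModuleCat.of R R) i)
  ext_dual_eq_zero : ∀ i : ℕ, 1 ≤ i →
    Subsingleton (Abelian.Ext.{u} (ModuleCat.of R (Module.Dual R G)) (ModuleCat.of R R) i)

/-- `T` is a totally acyclic complex of projective modules: every `T_i` is projective, `T` is
acyclic, and `Hom(T, Q)` is acyclic for every projective module `Q`. -/
structure IsTotallyAcyclic (T : ChainComplex (ModuleCat.{u} R) ℤ) : Prop where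
  projective : ∀ i : ℤ, Module.Projective R (T.X i)
  acyclic : T.Acyclic
  hom_acyclic : ∀ (Q : Type u) [AddCommGroup Q] [Module R Q], Module.Projective R Q →
    ∀ i : ℤ, Function.Exact
      (fun f : T.X (i - 1) →ₗ[R] Q => f ∘ₗ (T.d i (i - 1)).hom)
      (fun f : T.X i →ₗ[R] Q => f ∘ₗ (T.d (i + 1) i).hom)

/-- `T` is a complete projective resolution of the module `M`: it is a totally acyclic complex of
projective modules with `Coker (T_1 → T_0) ≅ M`. -/
structure IsCompleteResolution (T : ChainComplex (ModuleCat.{u} R) ℤ) (M : Type u)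
    [AddCommGroup M] [Module R M] : Prop where
  totallyAcyclic : IsTotallyAcyclic T
  coker_equiv : Nonempty ((T.X 0 ⧸ LinearMap.range (T.d 1 0).hom) ≃ₗ[R] M)

/-- `F` is a minimal complex of finitely generated free modules: `∂(F) ⊆ 𝔪 F`. -/
structure IsMinimalComplex [IsLocalRing R] (F : ChainComplex (ModuleCat.{u} R) ℤ) : Prop where
  free : ∀ i : ℤ, Module.Free R (F.X i)
  finite : ∀ i : ℤ, Module.Finite R (F.X i)
  range_le : ∀ i : ℤ, LinearMap.range (F.d (i + 1) i).hom ≤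
    IsLocalRing.maximalIdeal R • (⊤ : Submodule R (F.X i))

/-- The Tate homology module `H_i(T ⊗ N)` of `M` with coefficients in `N`, where `T` is a complete
projective resolution of `M`. -/
def tateHomology (T : ChainComplex (ModuleCat.{u} R) ℤ) (N : Type u) [AddCommGroup N]
    [Module R N] (i : ℤ) : ModuleCat.{u} R :=
  (((MonoidalCategory.tensorRight (ModuleCat.of R N)).mapHomologicalComplex _).obj T).homology i

namespace PinchedTensor

/-- The bidegrees `(i, j)` such that `T_i ⊗ A_j` is a summand of the pinched tensor product in
degree `n`. For `n ≥ 0` these are the `(i, j)` with `i, j ≥ 0` and `i + j = n`; for `n ≤ -1`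
they are the `(i, j)` with `i, j ≤ -1` and `i + (j + 1) = n`, as `A_j` is the component of the
shift of `A` in degree `j + 1`. -/
def Mem (n i j : ℤ) : Prop :=
  (0 ≤ i ∧ 0 ≤ j ∧ i + j = n) ∨ (i ≤ -1 ∧ j ≤ -1 ∧ i + (j + 1) = n)

instance (n i j : ℤ) : Decidable (Mem n i j) := by unfold Mem; infer_instance

/-- The set of bidegrees that occur in degree `n`. -/
abbrev Idx (n : ℤ) : Type := {p : ℤ × ℤ // Mem n p.1 p.2}

variable (T A : ChainComplex (ModuleCat.{u} R) ℤ)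

/-- The pinched tensor product in degree `n`. -/
abbrev Obj (n : ℤ) : Type u := ⨁ p : Idx n, (T.X p.1.1 ⊗[R] A.X p.1.2)

/-- The inclusion of `T_i ⊗ A_j` into degree `n` if it is one of the summands there, and zero
otherwise. -/
def incl (n i j : ℤ) : (T.X i ⊗[R] A.X j) →ₗ[R] Obj T A n :=
  if h : Mem n i j then
    DirectSum.lof R (Idx n) (fun p => T.X p.1.1 ⊗[R] A.X p.1.2) ⟨(i, j), h⟩
  else 0

/-- The Koszul sign in front of `x ⊗ ∂y`, for `x` of degree `i`; in negative degrees there is the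
additional sign from the differential of the shift of `A`. -/
def sign (i : ℤ) : ℤˣ := if 0 ≤ i then i.negOnePow else -i.negOnePow

/-- The differential from degree `n + 1` to degree `n` on the summand `T_i ⊗ A_j`. It is
`x ⊗ y ↦ ∂x ⊗ y ± x ⊗ ∂y`, where the terms outside the truncations vanish, and
`x ⊗ y ↦ ∂x ⊗ ∂y` from degree `0` to degree `-1`. The last summand of the formula is nonzero only
for `n = -1`, and then the first two vanish. -/
def diffOn (n i j : ℤ) : (T.X i ⊗[R] A.X j) →ₗ[R] Obj T A n :=
  incl T A n (i - 1) j ∘ₗ TensorProduct.map (T.d i (i - 1)).hom LinearMap.id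
  + ((sign i : ℤˣ) : ℤ) •
      (incl T A n i (j - 1) ∘ₗ TensorProduct.map LinearMap.id (A.d j (j - 1)).hom)
  + incl T A n (-1) (-1) ∘ₗ TensorProduct.map (T.d i (-1)).hom (A.d j (-1)).hom

/-- The differential of the pinched tensor product from degree `n + 1` to degree `n`. -/
def diff (n : ℤ) : Obj T A (n + 1) →ₗ[R] Obj T A n :=
  DirectSum.toModule R (Idx (n + 1)) (Obj T A n) fun p => diffOn T A n p.1.1 p.1.2

lemma diff_comp_incl (n i j : ℤ) (h : Mem (n + 1) i j) :
    diff T A n ∘ₗ incl T A (n + 1) i j = diffOn T A n i j := by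
  ext x y
  simp [diff, incl, h]

lemma diff_comp_incl_of_not (n i j : ℤ) (h : ¬ Mem (n + 1) i j) :
    diff T A n ∘ₗ incl T A (n + 1) i j = 0 := by
  simp [incl, h]

lemma d_d_apply (C : ChainComplex (ModuleCat.{u} R) ℤ) (i j k : ℤ) (x : C.X i) :
    (C.d j k).hom ((C.d i j).hom x) = 0 := by
  rw [← LinearMap.comp_apply, ← ModuleCat.hom_comp, C.d_comp_d]
  rfl

lemma incl_of_not (n i j : ℤ) (h : ¬ Mem n i j) : incl T A n i j = 0 := by
  simp [incl, h]

lemma diff_incl_apply (n i j : ℤ) (h : Mem (n + 1) i j) (z : T.X i ⊗[R] A.X j) :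
    diff T A n (incl T A (n + 1) i j z) = diffOn T A n i j z :=
  LinearMap.congr_fun (diff_comp_incl T A n i j h) z

lemma diff_incl_apply_of_not (n i j : ℤ) (h : ¬ Mem (n + 1) i j) (z : T.X i ⊗[R] A.X j) :
    diff T A n (incl T A (n + 1) i j z) = 0 :=
  LinearMap.congr_fun (diff_comp_incl_of_not T A n i j h) z

lemma diff_diffOn_apply (n i j : ℤ) (h : Mem (n + 1 + 1) i j) (x : T.X i) (y : A.X j) :
    diff T A n (diffOn T A (n + 1) i j (x ⊗ₜ[R] y)) = 0 := by
  have h1 : diff T A n (incl T A (n + 1) (i - 1) j ((T.d i (i - 1)).hom x ⊗ₜ[R] y)) =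
      ((sign (i - 1) : ℤˣ) : ℤ) • incl T A n (i - 1) (j - 1)
        ((T.d i (i - 1)).hom x ⊗ₜ[R] (A.d j (j - 1)).hom y) := by
    by_cases hm : Mem (n + 1) (i - 1) j
    · rw [diff_incl_apply _ _ _ _ _ hm]
      simp [diffOn, d_d_apply]
    · rw [diff_incl_apply_of_not _ _ _ _ _ hm, incl_of_not, LinearMap.zero_apply, smul_zero]
      unfold Mem at *
      omega
  have h2 : diff T A n (incl T A (n + 1) i (j - 1) (x ⊗ₜ[R] (A.d j (j - 1)).hom y)) =
      incl T A n (i - 1) (j - 1)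
        ((T.d i (i - 1)).hom x ⊗ₜ[R] (A.d j (j - 1)).hom y) := by
    by_cases hm : Mem (n + 1) i (j - 1)
    · rw [diff_incl_apply _ _ _ _ _ hm]
      simp [diffOn, d_d_apply]
    · rw [diff_incl_apply_of_not _ _ _ _ _ hm, incl_of_not, LinearMap.zero_apply]
      unfold Mem at *
      omega
  have h3 : diff T A n (incl T A (n + 1) (-1) (-1)
      ((T.d i (-1)).hom x ⊗ₜ[R] (A.d j (-1)).hom y)) = 0 := by
    by_cases hm : Mem (n + 1) (-1) (-1)
    · rw [diff_incl_apply _ _ _ _ _ hm]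
      simp [diffOn, d_d_apply]
    · rw [diff_incl_apply_of_not _ _ _ _ _ hm]
  simp only [diffOn, LinearMap.add_apply, LinearMap.smul_apply, LinearMap.comp_apply,
    TensorProduct.map_tmul, LinearMap.id_apply, map_add, map_zsmul, h1, h2, h3, add_zero]
  by_cases hm : Mem n (i - 1) (j - 1)
  · have hs : sign (i - 1) = - sign i := by
      have h4 : (i - 1).negOnePow = - i.negOnePow := by
        rw [← neg_eq_iff_eq_neg, ← Int.negOnePow_succ, sub_add_cancel]
      unfold sign
      unfold Mem at *
      by_cases hi : 0 ≤ i
      · rw [if_pos hi, if_pos (by omega), h4]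
      · rw [if_neg hi, if_neg (by omega), h4]
    rw [hs, ← add_smul]
    simp
  · rw [incl_of_not _ _ _ _ _ hm]
    simp

lemma diff_comp_diff (n : ℤ) : diff T A n ∘ₗ diff T A (n + 1) = 0 := by
  refine DirectSum.linearMap_ext R fun p => TensorProduct.ext' fun x y => ?_
  have := diff_diffOn_apply T A n p.1.1 p.1.2 p.2 x y
  simpa [diff] using this

end PinchedTensor

/-- The pinched tensor product of the complexes `T` and `A`. -/
def pinchedTensor (T A : ChainComplex (ModuleCat.{u} R) ℤ) : ChainComplex (ModuleCat.{u} R) ℤ :=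
  ChainComplex.of (fun n => ModuleCat.of R (PinchedTensor.Obj T A n))
    (fun n => ModuleCat.ofHom (PinchedTensor.diff T A n))
    (fun n => by
      rw [← ModuleCat.ofHom_comp, PinchedTensor.diff_comp_diff]
      rfl)

end

/-! Two observations carry the theorem. First, over a Gorenstein ring total acyclicity comes for
free. Since `R` is Noetherian of finite injective dimension, so is every free module, and dimension
shifting along the cokernels of an acyclic complex of projectives kills their higher `Ext` into free
modules, hence into projectives (`IsGorensteinLocal.isTotallyAcyclic`). The same shift shows that a
finitely generated module with a complete resolution has no higher `Ext` into `R`. Shifting again,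
along the duals of its syzygies, then gives total reflexivity (`IsExtFree.isTotallyReflexive`).

Second, the pinched tensor product is acyclic (`PinchedTensor.exists_diff_eq`). Morally its
nonnegative half `T_{≥0} ⊗ T'_{≥0}` computes `T_{≥0} ⊗ N`, because `T'_{≥0}` resolves `N` and each
`T_i` is flat. Its negative half likewise computes `T_{<0} ⊗ N`, because `T'_{<0}` coresolves `N`.
The map `∂ ⊗ ∂` joins the halves as the differential of `T` joins those of `T ⊗ N`, and `T ⊗ N` is
exact by vanishing of Tate homology. The proof carries this out on elements, correcting a cycle one
bidegree at a time. The cokernel in degree zero is `M ⊗ N` by right exactness. -/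

/-! ### Injective dimension of direct sums of copies. -/

section FiniteInjectiveDimension

variable {R : Type u} [CommRing R]

/-- Over a Noetherian ring, a direct sum of copies of a module satisfying Baer's criterion
satisfies Baer's criterion. -/
lemma Module.Baer.finsupp [IsNoetherianRing R] {E : Type*} [AddCommGroup E] [Module R E]
    (hE : Module.Baer R E) (ι : Type*) : Module.Baer R (ι →₀ E) := by
  classical
  intro I g
  obtain ⟨s, hs⟩ := (IsNoetherian.noetherian I : I.FG)
  have hI : ∀ k, ∃ φ : R →ₗ[R] E, ∀ x (mem : x ∈ I), φ x = g ⟨x, mem⟩ k := fun k =>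
    hE I (Finsupp.lapply k ∘ₗ g)
  choose φ hφ using hI
  -- The coordinates where `g` is nonzero on some generator. As `I` is finitely generated there are
  -- finitely many, and `g` vanishes in all others.
  let S : Finset ι := s.attach.biUnion fun x =>
    (g ⟨x.1, hs ▸ Submodule.subset_span x.2⟩).support
  have hS : ∀ y : I, ∀ k ∉ S, g y k = 0 := by
    intro y k hk
    have hle : I ≤ (LinearMap.ker (Finsupp.lapply (R := R) k ∘ₗ g)).map I.subtype := by
      conv_lhs => rw [← hs]
      rw [Submodule.span_le]
      intro x hx
      refine ⟨⟨x, hs ▸ Submodule.subset_span hx⟩, ?_, rfl⟩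
      by_contra hne
      refine hk (Finset.mem_biUnion.2 ⟨⟨x, hx⟩, Finset.mem_attach _ _, ?_⟩)
      simpa using hne
    obtain ⟨z, hz, hzy⟩ := hle y.2
    obtain rfl : z = y := Subtype.ext hzy
    exact hz
  refine ⟨∑ k ∈ S, Finsupp.lsingle k ∘ₗ φ k, fun x mem => Finsupp.ext fun k => ?_⟩
  simp only [LinearMap.sum_apply, LinearMap.comp_apply, Finsupp.lsingle_apply,
    Finsupp.finsetSum_apply, Finsupp.single_apply]
  rw [Finset.sum_ite_eq']
  split_ifs with hk
  · exact hφ k x mem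
  · exact (hS ⟨x, mem⟩ k hk).symm

/-- Over a Noetherian ring, the injective dimension does not grow under direct sums of copies. -/
lemma hasInjectiveDimensionLE_finsupp [IsNoetherianRing R] (ι : Type u) (n : ℕ)
    (X : Type u) [AddCommGroup X] [Module R X]
    (h : HasInjectiveDimensionLE (ModuleCat.of R X) n) :
    HasInjectiveDimensionLE (ModuleCat.of R (ι →₀ X)) n := by
  induction n generalizing X with
  | zero =>
    simp only [HasInjectiveDimensionLE, zero_add, ← injective_iff_hasInjectiveDimensionLT_one,
      ← Module.injective_iff_injective_object, ← Module.Baer.iff_injective] at h ⊢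
    exact h.finsupp ι
  | succ n ih =>
    -- Embed `X` in an injective: the cokernel has dimension one less, and the sequence stays exact
    -- on direct sums of copies, with injective middle term by the Baer lemma.
    obtain ⟨I, _, f, _⟩ := (EnoughInjectives.presentation (ModuleCat.of R X)).some
    have injf : Function.Injective f.hom := (ModuleCat.mono_iff_injective f).mp ‹_›
    let S : ShortComplex (ModuleCat.{u} R) :=
      ModuleCat.shortComplexOfCompEqZero _ _ f.hom.exact_map_mkQ_range.linearMap_comp_eq_zero
    have hS := ModuleCat.shortComplex_shortExact S
      f.hom.exact_map_mkQ_range injf (Submodule.mkQ_surjective _)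
    have hC := ih _ ((hS.hasInjectiveDimensionLT_X₃_iff n ‹_›).2 h)
    have hex : Function.Exact (Finsupp.mapRange.linearMap (α := ι) f.hom)
        (Finsupp.mapRange.linearMap (α := ι) (LinearMap.range f.hom).mkQ) := by
      intro y
      refine ⟨fun hy => ?_, ?_⟩
      · have hy' : ∀ k, ∃ x, f.hom x = y k := fun k => by
          simpa using DFunLike.congr_fun hy k
        choose x hx using hy'
        refine ⟨Finsupp.onFinset y.support x fun k hk => ?_, Finsupp.ext fun k => hx k⟩
        rw [Finsupp.mem_support_iff, ← hx k]
        exact fun h0 => hk (injf (h0.trans (map_zero _).symm))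
      · rintro ⟨x, rfl⟩
        ext k
        simp
    let S' : ShortComplex (ModuleCat.{u} R) :=
      ModuleCat.shortComplexOfCompEqZero _ _ hex.linearMap_comp_eq_zero
    have hS' := ModuleCat.shortComplex_shortExact S' hex
      (Finsupp.mapRange_injective _ (map_zero _) injf)
      (Finsupp.mapRange_surjective _ (map_zero _) (Submodule.mkQ_surjective _))
    have hI : Injective (ModuleCat.of R (ι →₀ I)) := by
      rw [← Module.injective_iff_injective_object, ← Module.Baer.iff_injective]
      apply Module.Baer.finsupp
      rw [Module.Baer.iff_injective, Module.injective_iff_injective_object]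
      assumption
    exact (hS'.hasInjectiveDimensionLT_X₃_iff n hI).1 hC

end FiniteInjectiveDimension

/-! ### Dimension shifting and extension of maps. -/

section ExtShift

variable {R : Type u} [CommRing R] {K P L : Type u} [AddCommGroup K] [Module R K]
  [AddCommGroup P] [Module R P] [AddCommGroup L] [Module R L]
  {f : K →ₗ[R] P} {g : P →ₗ[R] L}

lemma shortExact_of_exact (hf : Function.Injective f) (hfg : Function.Exact f g)
    (hg : Function.Surjective g) :
    (ModuleCat.shortComplexOfCompEqZero f g hfg.linearMap_comp_eq_zero).ShortExact :=
  ModuleCat.shortComplex_shortExact _ hfg hf hg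

/-- Dimension shifting: `Ext^i(K, Q) = 0` if `Ext^{i+1}(L, Q) = 0`, for `0 → K → P → L → 0` exact
with `P` projective and `i ≥ 1`. -/
lemma subsingleton_ext_of_succ (hf : Function.Injective f) (hfg : Function.Exact f g)
    (hg : Function.Surjective g) [Module.Projective R P] (Q : ModuleCat.{u} R) (i : ℕ)
    (hi : 1 ≤ i) (h : Subsingleton (Abelian.Ext.{u} (ModuleCat.of R L) Q (i + 1))) :
    Subsingleton (Abelian.Ext.{u} (ModuleCat.of R K) Q i) := by
  obtain ⟨i, rfl⟩ := Nat.exists_eq_add_of_le' hi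
  have hS := shortExact_of_exact hf hfg hg
  have : Projective (ModuleCat.of R P) := (IsProjective.iff_projective P).1 inferInstance
  refine subsingleton_of_forall_eq 0 fun x => ?_
  obtain ⟨y, rfl⟩ := Abelian.Ext.contravariant_sequence_exact₁ hS Q x (add_comm 1 (i + 1))
    (Subsingleton.elim _ _)
  rw [y.eq_zero_of_projective]
  simp

/-- If `Ext^1(L, Q) = 0`, every linear map `K → Q` extends to `P`. -/
lemma exists_extension_of_subsingleton_ext (hf : Function.Injective f)
    (hfg : Function.Exact f g) (hg : Function.Surjective g) (Q : Type u) [AddCommGroup Q]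
    [Module R Q]
    (h : Subsingleton (Abelian.Ext.{u} (ModuleCat.of R L) (ModuleCat.of R Q) 1)) (a : K →ₗ[R] Q) :
    ∃ b : P →ₗ[R] Q, b ∘ₗ f = a := by
  have hS := shortExact_of_exact hf hfg hg
  obtain ⟨y, hy⟩ := Abelian.Ext.contravariant_sequence_exact₁ hS (ModuleCat.of R Q)
    (Abelian.Ext.mk₀ (ModuleCat.ofHom a)) (add_zero 1) (Subsingleton.elim _ _)
  obtain ⟨b, rfl⟩ := Abelian.Ext.mk₀_bijective _ _ |>.2 y
  rw [Abelian.Ext.mk₀_comp_mk₀] at hy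
  exact ⟨b.hom, congrArg ModuleCat.Hom.hom ((Abelian.Ext.mk₀_bijective _ _).1 hy)⟩

end ExtShift

/-! ### Acyclic complexes of projectives and total acyclicity. -/

section AcyclicComplexes

variable {R : Type u} [CommRing R]

lemma exact_of_exactAt (X : ChainComplex (ModuleCat.{u} R) ℤ) {i j k : ℤ} (hij : i = j + 1)
    (hjk : j = k + 1) (h : X.ExactAt j) : Function.Exact (X.d i j).hom (X.d j k).hom := by
  rw [X.exactAt_iff' i j k (by simp [hij]) (by simp [hjk]),
    ShortComplex.ShortExact.moduleCat_exact_iff_function_exact] at h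
  exact h

lemma exactAt_of_exact (X : ChainComplex (ModuleCat.{u} R) ℤ) {i j k : ℤ} (hij : i = j + 1)
    (hjk : j = k + 1) (h : Function.Exact (X.d i j).hom (X.d j k).hom) : X.ExactAt j := by
  rw [X.exactAt_iff' i j k (by simp [hij]) (by simp [hjk]),
    ShortComplex.ShortExact.moduleCat_exact_iff_function_exact]
  exact h

variable (X : ChainComplex (ModuleCat.{u} R) ℤ)

/-- The cokernel of the differential `X_i → X_j`. -/
abbrev cokerD (i j : ℤ) : Type u := X.X j ⧸ LinearMap.range (X.d i j).hom

/-- The map from the cokernel of `X_i → X_j` to `X_k` induced by the differential. -/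
def cokerDesc (i j k : ℤ) : cokerD X i j →ₗ[R] X.X k :=
  (LinearMap.range (X.d i j).hom).liftQ (X.d j k).hom <| by
    rintro _ ⟨x, rfl⟩
    exact PinchedTensor.d_d_apply X i j k x

variable {X}

lemma cokerDesc_injective {i j k : ℤ} (h : Function.Exact (X.d i j).hom (X.d j k).hom) :
    Function.Injective (cokerDesc X i j k) := by
  rw [← LinearMap.ker_eq_bot]
  exact Submodule.ker_liftQ_eq_bot _ _ _ h.linearMap_ker_eq.le

lemma exact_cokerDesc_mkQ (i j k : ℤ) :
    Function.Exact (cokerDesc X i j k) (LinearMap.range (X.d j k).hom).mkQ := by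
  rw [LinearMap.exact_iff, Submodule.ker_mkQ, cokerDesc, Submodule.range_liftQ]

/-- In an acyclic complex of projective modules, the higher `Ext` of the cokernels with values in
a module of finite injective dimension vanish. -/
lemma subsingleton_ext_cokerD (hX : X.Acyclic) (hproj : ∀ i, Module.Projective R (X.X i))
    (Q : ModuleCat.{u} R) (n : ℕ) [HasInjectiveDimensionLE Q n] (m : ℕ) (hm : 1 ≤ m) (i j : ℤ)
    (hij : i = j + 1) : Subsingleton (Abelian.Ext.{u} (ModuleCat.of R (cokerD X i j)) Q m) := by
  -- Here `k` bounds how far `m` lies below the range where the injective dimension forces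
  -- vanishing. Each step raises `m` by one and passes to the next cokernel down the complex.
  suffices ∀ k m : ℕ, 1 ≤ m → n + 1 ≤ m + k → ∀ i j : ℤ, i = j + 1 →
      Subsingleton (Abelian.Ext.{u} (ModuleCat.of R (cokerD X i j)) Q m) from
    this n m hm (by omega) i j hij
  intro k
  induction k with
  | zero =>
    intro m _ hk i j _
    exact HasInjectiveDimensionLT.subsingleton Q (n + 1) m hk _
  | succ k ih =>
    intro m hm hk i j hij
    exact subsingleton_ext_of_succ
      (cokerDesc_injective (exact_of_exactAt X hij (by omega : j = (j - 1) + 1) (hX j)))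
      (exact_cokerDesc_mkQ i j (j - 1)) (Submodule.mkQ_surjective _) Q m hm
      (ih (m + 1) (by omega) (by omega) j (j - 1) (by omega))

/-- An acyclic complex of projective modules stays exact after applying `Hom(-, Q)`, for `Q` of
finite injective dimension. -/
lemma exists_comp_d_eq (hX : X.Acyclic) (hproj : ∀ i, Module.Projective R (X.X i))
    (Q : Type u) [AddCommGroup Q] [Module R Q] (n : ℕ)
    [HasInjectiveDimensionLE (ModuleCat.of R Q) n] {i j k : ℤ} (hij : i = j + 1) (hjk : j = k + 1)
    (f : X.X j →ₗ[R] Q) (hf : f ∘ₗ (X.d i j).hom = 0) :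
    ∃ g : X.X k →ₗ[R] Q, g ∘ₗ (X.d j k).hom = f := by
  have hle : LinearMap.range (X.d i j).hom ≤ LinearMap.ker f := by
    rwa [LinearMap.range_le_ker_iff]
  -- A map killing boundaries lives on the cokernel, which embeds in `X_k`; the obstruction to
  -- extending it is an `Ext^1` of the next cokernel.
  obtain ⟨g, hg⟩ := exists_extension_of_subsingleton_ext
    (cokerDesc_injective (exact_of_exactAt X hij hjk (hX j)))
    (exact_cokerDesc_mkQ i j k) (Submodule.mkQ_surjective _) Q
    (subsingleton_ext_cokerD hX hproj (ModuleCat.of R Q) n 1 le_rfl j k hjk)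
    ((LinearMap.range (X.d i j).hom).liftQ f hle)
  refine ⟨g, LinearMap.ext fun x => ?_⟩
  exact LinearMap.congr_fun hg (Submodule.Quotient.mk x)

variable [IsLocalRing R] [IsNoetherianRing R]

/-- Over a Gorenstein ring, every acyclic complex of projective modules is totally acyclic. -/
lemma IsGorensteinLocal.isTotallyAcyclic (hR : IsGorensteinLocal R) (hX : X.Acyclic)
    (hproj : ∀ i, Module.Projective R (X.X i)) : IsTotallyAcyclic X where
  projective := hproj
  acyclic := hX
  hom_acyclic Q _ _ hQ i := by
    obtain ⟨n, hn⟩ := hR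
    intro f
    refine ⟨fun hf => ?_, ?_⟩
    -- `Q` is a retract of the free module `Q →₀ R`: extend `s ∘ₗ f` there, then retract.
    · obtain ⟨s, hs⟩ := Module.projective_def'.1 hQ
      have := hasInjectiveDimensionLE_finsupp Q n R hn
      obtain ⟨g, hg⟩ := exists_comp_d_eq hX hproj (Q →₀ R) n (rfl : i + 1 = i + 1)
        (by omega : i = (i - 1) + 1) (s ∘ₗ f) (by
          rw [LinearMap.comp_assoc]
          exact (congrArg (s ∘ₗ ·) hf).trans (LinearMap.comp_zero _))
      refine ⟨Finsupp.linearCombination R id ∘ₗ g, ?_⟩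
      change (Finsupp.linearCombination R id ∘ₗ g) ∘ₗ _ = f
      rw [LinearMap.comp_assoc, hg, ← LinearMap.comp_assoc, hs, LinearMap.id_comp]
    · rintro ⟨g, rfl⟩
      ext x
      simp [PinchedTensor.d_d_apply]

end AcyclicComplexes

/-! ### Total reflexivity from one-sided vanishing of `Ext`. -/

section TotallyReflexive

variable {R : Type u} [CommRing R]

/-- The class of finitely generated modules `G` with `Ext^i(G, R) = 0` for all `i ≥ 1`. -/
structure IsExtFree (R : Type u) [CommRing R] (G : Type u) [AddCommGroup G] [Module R G] :
    Prop where
  finite : Module.Finite R G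
  ext_eq_zero : ∀ i : ℕ, 1 ≤ i →
    Subsingleton (Abelian.Ext.{u} (ModuleCat.of R G) (ModuleCat.of R R) i)

lemma exact_dualMap {K P L : Type*} [AddCommGroup K] [Module R K] [AddCommGroup P] [Module R P]
    [AddCommGroup L] [Module R L] {f : K →ₗ[R] P} {g : P →ₗ[R] L} (hfg : Function.Exact f g)
    (hg : Function.Surjective g) : Function.Exact g.dualMap f.dualMap := by
  intro φ
  refine ⟨fun hφ => ?_, ?_⟩
  · have hle : LinearMap.ker g ≤ LinearMap.ker φ := by
      rw [hfg.linearMap_ker_eq, LinearMap.range_le_ker_iff]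
      exact hφ
    refine ⟨(LinearMap.ker g).liftQ φ hle ∘ₗ (g.quotKerEquivOfSurjective hg).symm.toLinearMap,
      LinearMap.ext fun x => ?_⟩
    have : (g.quotKerEquivOfSurjective hg).symm (g x) = Submodule.Quotient.mk x := by
      rw [LinearEquiv.symm_apply_eq]
      rfl
    simp [this]
  · rintro ⟨ψ, rfl⟩
    ext x
    simp [hfg.apply_apply_eq_zero]

lemma dualMap_surjective_of_subsingleton_ext {K P L : Type u} [AddCommGroup K] [Module R K]
    [AddCommGroup P] [Module R P] [AddCommGroup L] [Module R L] {f : K →ₗ[R] P} {g : P →ₗ[R] L}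
    (hf : Function.Injective f) (hfg : Function.Exact f g) (hg : Function.Surjective g)
    (h : Subsingleton (Abelian.Ext.{u} (ModuleCat.of R L) (ModuleCat.of R R) 1)) :
    Function.Surjective f.dualMap := fun a =>
  exists_extension_of_subsingleton_ext hf hfg hg R h a

namespace IsExtFree

variable [IsNoetherianRing R] {G : Type u} [AddCommGroup G] [Module R G]

/-- The first syzygy. -/
lemma exists_syzygy (hG : IsExtFree R G) : ∃ (n : ℕ) (g : (Fin n → ULift.{u} R) →ₗ[R] G),
    Function.Surjective g ∧ IsExtFree R (LinearMap.ker g) := by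
  have := hG.finite
  obtain ⟨n, g', hg'⟩ := Module.Finite.exists_fin' R G
  let e : (Fin n → ULift.{u} R) ≃ₗ[R] (Fin n → R) :=
    LinearEquiv.piCongrRight fun _ => ULift.moduleEquiv
  let g := g' ∘ₗ e.toLinearMap
  have hg : Function.Surjective g := hg'.comp e.surjective
  refine ⟨n, g, hg, inferInstance, fun i hi => ?_⟩
  exact subsingleton_ext_of_succ (LinearMap.ker g).injective_subtype
    (LinearMap.exact_subtype_ker_map g) hg _ i hi (hG.ext_eq_zero (i + 1) (by omega))

/-- Dualizing `0 → K → F → G → 0` keeps it exact, so `G*` is a syzygy of `K*`. As `K` is again in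
the class, `m` can be raised until it exceeds the injective dimension of `R`. -/
lemma ext_dual_eq_zero (n : ℕ) [HasInjectiveDimensionLE (ModuleCat.of R R) n]
    (hG : IsExtFree R G) (m : ℕ) (hm : 1 ≤ m) :
    Subsingleton (Abelian.Ext.{u} (ModuleCat.of R (Module.Dual R G)) (ModuleCat.of R R) m) := by
  suffices ∀ k m : ℕ, 1 ≤ m → n + 1 ≤ m + k → ∀ (G : Type u) [AddCommGroup G] [Module R G],
      IsExtFree R G → Subsingleton (Abelian.Ext.{u} (ModuleCat.of R (Module.Dual R G))
        (ModuleCat.of R R) m) from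
    this n m hm (by omega) G hG
  clear! G m
  intro k
  induction k with
  | zero =>
    intro m _ hk G _ _ _
    exact HasInjectiveDimensionLT.subsingleton _ (n + 1) m hk _
  | succ k ih =>
    intro m hm hk G _ _ hG
    obtain ⟨r, g, hg, hK⟩ := hG.exists_syzygy
    exact subsingleton_ext_of_succ (LinearMap.dualMap_injective_of_surjective hg)
      (exact_dualMap (LinearMap.exact_subtype_ker_map g) hg)
      (dualMap_surjective_of_subsingleton_ext (LinearMap.ker g).injective_subtype
        (LinearMap.exact_subtype_ker_map g) hg (hG.ext_eq_zero 1 le_rfl)) _ m hm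
      (ih (m + 1) (by omega) (by omega) _ hK)

/-- `F** → G**` is onto because `Ext^1(K*, R) = 0`, and `F` is reflexive. -/
lemma dual_eval_surjective (n : ℕ) [HasInjectiveDimensionLE (ModuleCat.of R R) n]
    (hG : IsExtFree R G) : Function.Surjective (Module.Dual.eval R G) := by
  obtain ⟨r, g, hg, hK⟩ := hG.exists_syzygy
  have h : Function.Surjective g.dualMap.dualMap :=
    dualMap_surjective_of_subsingleton_ext (LinearMap.dualMap_injective_of_surjective hg)
      (exact_dualMap (LinearMap.exact_subtype_ker_map g) hg)
      (dualMap_surjective_of_subsingleton_ext (LinearMap.ker g).injective_subtype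
        (LinearMap.exact_subtype_ker_map g) hg (hG.ext_eq_zero 1 le_rfl))
      (hK.ext_dual_eq_zero n 1 le_rfl)
  intro φ
  obtain ⟨ψ, rfl⟩ := h φ
  obtain ⟨x, rfl⟩ := (Module.bijective_dual_eval R (Fin r → ULift.{u} R)).2 ψ
  exact ⟨g x, rfl⟩

/-- If `x` in `F` dies in `G**`, its image in `F**` comes from `K**`, hence from `K` by surjectivity
of biduality for `K`. So `x` lies in `K`. -/
lemma dual_eval_injective (n : ℕ) [HasInjectiveDimensionLE (ModuleCat.of R R) n]
    (hG : IsExtFree R G) : Function.Injective (Module.Dual.eval R G) := by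
  obtain ⟨r, g, hg, hK⟩ := hG.exists_syzygy
  have hker := LinearMap.exact_subtype_ker_map g
  have hsurj := dualMap_surjective_of_subsingleton_ext (LinearMap.ker g).injective_subtype
    hker hg (hG.ext_eq_zero 1 le_rfl)
  have hex : Function.Exact (LinearMap.ker g).subtype.dualMap.dualMap g.dualMap.dualMap :=
    exact_dualMap (exact_dualMap hker hg) hsurj
  rw [injective_iff_map_eq_zero]
  intro y hy
  obtain ⟨x, rfl⟩ := hg y
  obtain ⟨κ, hκ⟩ := (hex (Module.Dual.eval R _ x)).1 hy
  obtain ⟨z, rfl⟩ := hK.dual_eval_surjective n κ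
  have : (z : Fin r → ULift.{u} R) = x :=
    (Module.bijective_dual_eval R (Fin r → ULift.{u} R)).1 hκ
  rw [← this]
  exact z.2

/-- Over a Gorenstein ring, a finitely generated module `G` with `Ext^i(G, R) = 0` for all
`i ≥ 1` is totally reflexive. -/
lemma isTotallyReflexive [IsLocalRing R] (hR : IsGorensteinLocal R) (hG : IsExtFree R G) :
    IsTotallyReflexive R G := by
  obtain ⟨n, hn⟩ := hR
  exact ⟨hG.finite, ⟨hG.dual_eval_injective n, hG.dual_eval_surjective n⟩, hG.ext_eq_zero,
    hG.ext_dual_eq_zero n⟩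

end IsExtFree

end TotallyReflexive

/-! ### Acyclicity of the pinched tensor product, by components. -/

namespace PinchedTensor

variable {R : Type u} [CommRing R] (T A : ChainComplex (ModuleCat.{u} R) ℤ)

/-- The projection from degree `n` onto `T_i ⊗ A_j` if it is one of the summands there, and zero
otherwise. -/
noncomputable def proj (n i j : ℤ) : Obj T A n →ₗ[R] (T.X i ⊗[R] A.X j) :=
  if h : Mem n i j then
    DirectSum.component R (Idx n) (fun p => T.X p.1.1 ⊗[R] A.X p.1.2) ⟨(i, j), h⟩
  else 0

lemma proj_of_not (n i j : ℤ) (h : ¬ Mem n i j) : proj T A n i j = 0 := by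
  simp [proj, h]

lemma proj_incl_self {n i j : ℤ} (h : Mem n i j) (x : T.X i ⊗[R] A.X j) :
    proj T A n i j (incl T A n i j x) = x := by
  simp [proj, incl, h]

lemma proj_incl_of_ne {n i j i' j' : ℤ} (h : (i', j') ≠ (i, j)) (x : T.X i ⊗[R] A.X j) :
    proj T A n i' j' (incl T A n i j x) = 0 := by
  unfold proj incl
  split_ifs with h1 h2
  · exact (DirectSum.component.of _ _ _ _).trans
      (dif_neg fun he => h (congrArg Subtype.val he).symm)
  all_goals rfl

variable {T A} in
lemma eq_zero_of_proj {n : ℤ} (z : Obj T A n) (h : ∀ i j, Mem n i j → proj T A n i j z = 0) :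
    z = 0 := by
  refine DFinsupp.ext fun p => ?_
  have := h p.1.1 p.1.2 p.2
  rw [proj, dif_pos p.2] at this
  exact this

lemma linearMap_ext_incl {n : ℤ} {Q : Type*} [AddCommGroup Q] [Module R Q]
    {f g : Obj T A n →ₗ[R] Q}
    (h : ∀ i j, Mem n i j → ∀ x, f (incl T A n i j x) = g (incl T A n i j x)) : f = g := by
  refine DirectSum.linearMap_ext R fun p => LinearMap.ext fun x => ?_
  have := h p.1.1 p.1.2 p.2 x
  rw [incl, dif_pos p.2] at this
  exact this

/-- The components of the differential. -/
lemma proj_diff {n i j i' j' : ℤ} (h : Mem n i j) (hi : i' = i + 1) (hj : j' = j + 1)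
    (z : Obj T A (n + 1)) :
    proj T A n i j (diff T A n z) =
      (T.d i' i).hom.rTensor _ (proj T A (n + 1) i' j z)
      + ((sign i : ℤˣ) : ℤ) • (A.d j' j).hom.lTensor _ (proj T A (n + 1) i j' z)
      + TensorProduct.map (T.d 0 i).hom (A.d 0 j).hom (proj T A (n + 1) 0 0 z) := by
  suffices proj T A n i j ∘ₗ diff T A n =
      (T.d i' i).hom.rTensor _ ∘ₗ proj T A (n + 1) i' j
      + ((sign i : ℤˣ) : ℤ) • (A.d j' j).hom.lTensor _ ∘ₗ proj T A (n + 1) i j'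
      + TensorProduct.map (T.d 0 i).hom (A.d 0 j).hom ∘ₗ proj T A (n + 1) 0 0 from
    LinearMap.congr_fun this z
  refine linearMap_ext_incl T A fun k l hkl x => ?_
  simp only [LinearMap.comp_apply, LinearMap.add_apply, LinearMap.smul_apply,
    diff_incl_apply _ _ _ _ _ hkl, diffOn, map_add, map_zsmul]
  congr 1
  · congr 1
    · by_cases hc : (i', j) = (k, l)
      · obtain ⟨rfl, rfl⟩ := Prod.mk.inj hc
        obtain rfl : i = i' - 1 := by omega
        rw [proj_incl_self _ _ hkl, proj_incl_self _ _ h]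
        rfl
      · rw [proj_incl_of_ne _ _ hc, proj_incl_of_ne, map_zero]
        simp only [ne_eq, Prod.mk.injEq] at hc ⊢
        omega
    · by_cases hc : (i, j') = (k, l)
      · obtain ⟨rfl, rfl⟩ := Prod.mk.inj hc
        obtain rfl : j = j' - 1 := by omega
        rw [proj_incl_self _ _ hkl, proj_incl_self _ _ h]
        rfl
      · rw [proj_incl_of_ne _ _ hc, proj_incl_of_ne, map_zero, smul_zero, smul_zero]
        simp only [ne_eq, Prod.mk.injEq] at hc ⊢
        omega
  · by_cases hc : (0, 0) = (k, l)
    · obtain ⟨rfl, rfl⟩ := Prod.mk.inj hc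
      obtain rfl : n = -1 := by unfold Mem at hkl; omega
      obtain rfl : i = -1 := by unfold Mem at h; omega
      obtain rfl : j = -1 := by unfold Mem at h; omega
      rw [proj_incl_self _ _ hkl, proj_incl_self _ _ h]
    · rw [proj_incl_of_ne _ _ hc, map_zero]
      -- Outside bidegree `(0, 0)` one of the two differentials into degree `-1` has the wrong
      -- source.
      have : TensorProduct.map (T.d k (-1)).hom (A.d l (-1)).hom = 0 := by
        by_cases hk : k = 0
        · rw [A.shape l (-1) (fun h => hc (by simpa [hk] using h))]
          simp
        · rw [T.shape k (-1) (fun h => hk (by simpa using h.symm))]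
          simp
      rw [this, LinearMap.zero_apply, map_zero, map_zero]

lemma map_d_d_eq_zero_left {k i j : ℤ} (hi : i ≠ -1) :
    TensorProduct.map (T.d 0 i).hom (A.d k j).hom = 0 := by
  rw [T.shape 0 i (by intro h; simp at h; omega)]
  simp

lemma map_d_d_eq_zero_right {k i j : ℤ} (hj : j ≠ -1) :
    TensorProduct.map (T.d k i).hom (A.d 0 j).hom = 0 := by
  rw [A.shape 0 j (by intro h; simp at h; omega)]
  simp

lemma sign_smul_sign_smul {Q : Type*} [AddCommGroup Q] (i : ℤ) (x : Q) :
    ((sign i : ℤˣ) : ℤ) • ((sign i : ℤˣ) : ℤ) • x = x := by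
  rw [smul_smul, ← Units.val_mul, Int.units_mul_self, Units.val_one, one_smul]

lemma eq_zero_of_sign_smul {Q : Type*} [AddCommGroup Q] {i : ℤ} {x : Q}
    (h : ((sign i : ℤˣ) : ℤ) • x = 0) : x = 0 := by
  rw [← sign_smul_sign_smul i x, h, smul_zero]

lemma lTensor_rTensor_comm {P P' Q Q' : Type*} [AddCommGroup P] [Module R P] [AddCommGroup P']
    [Module R P'] [AddCommGroup Q] [Module R Q] [AddCommGroup Q'] [Module R Q']
    (f : P →ₗ[R] P') (g : Q →ₗ[R] Q') (x : P ⊗[R] Q) :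
    g.lTensor P' (f.rTensor Q x) = f.rTensor Q' (g.lTensor P x) := by
  rw [← LinearMap.comp_apply, ← LinearMap.comp_apply, LinearMap.lTensor_comp_rTensor,
    LinearMap.rTensor_comp_lTensor]

variable {T A}

/-- The components of `z` in bidegrees `(i, j)` with `i ≥ k` vanish. -/
def VanishesFrom {n : ℤ} (k : ℤ) (z : Obj T A n) : Prop :=
  ∀ i j, Mem n i j → k ≤ i → proj T A n i j z = 0

lemma VanishesFrom.proj_eq_zero {n k i j : ℤ} {z : Obj T A n} (hz : VanishesFrom k z)
    (hi : k ≤ i) : proj T A n i j z = 0 := by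
  by_cases h : Mem n i j
  · exact hz i j h hi
  · rw [proj_of_not _ _ _ _ _ h, LinearMap.zero_apply]

section Chase

variable [∀ i, Module.Flat R (T.X i)] {n : ℤ}

/-- Away from the edges `l = 0` and `l = -1`, both neighbours in the row `T_k ⊗ A` belong to the
pinched product. The leading component is a cycle there, and the row is exact since `T_k` is flat.
-/
lemma exists_vanishesFrom_of_ne (hA : A.Acyclic) {k l : ℤ} (hm : Mem (n + 1) k l)
    (h0 : l ≠ 0) (h1 : l ≠ -1) {z : Obj T A (n + 1)} (hz : diff T A n z = 0)
    (hv : VanishesFrom (k + 1) z) :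
    ∃ w, VanishesFrom k (z - diff T A (n + 1) w) := by
  have hm' : Mem n k (l - 1) := by unfold Mem at *; omega
  have hm'' : Mem (n + 1 + 1) k (l + 1) := by unfold Mem at *; omega
  have hker := proj_diff T A hm' rfl (by omega : l = (l - 1) + 1) z
  rw [hz, map_zero, hv.proj_eq_zero le_rfl, map_zero, zero_add,
    map_d_d_eq_zero_right T A (by omega), LinearMap.zero_apply, add_zero] at hker
  obtain ⟨w, hw⟩ := (Module.Flat.lTensor_exact (T.X k) (exact_of_exactAt A (rfl : l + 1 = l + 1)
    (by omega : l = (l - 1) + 1) (hA l)) _).1 (eq_zero_of_sign_smul hker.symm)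
  refine ⟨incl T A _ k (l + 1) (((sign k : ℤˣ) : ℤ) • w), fun i j hij hi => ?_⟩
  rw [map_sub, sub_eq_zero, proj_diff T A hij rfl rfl,
    proj_incl_of_ne (i' := i + 1) _ _ (by simp; omega),
    proj_incl_of_ne (i' := 0) _ _ (by simp; omega)]
  rcases hi.eq_or_lt with rfl | hi
  · obtain rfl : j = l := by unfold Mem at *; omega
    rw [proj_incl_self _ _ hm'', map_zsmul, sign_smul_sign_smul, hw]
    simp
  · rw [proj_incl_of_ne _ _ (by simp; omega), hv.proj_eq_zero (by omega)]
    simp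

variable {N : Type u} [AddCommGroup N] [Module R N] {π : A.X 0 →ₗ[R] N} {ι : N →ₗ[R] A.X (-1)}

-- The gluing map `∂ ⊗ ∂` is the differential of `T ⊗ N` preceded by `π` and followed by `ι`.
omit [∀ i, Module.Flat R (T.X i)] in
lemma map_d_d_apply (hc : ι ∘ₗ π = (A.d 0 (-1)).hom) (i j : ℤ) (x : T.X i ⊗[R] A.X 0) :
    TensorProduct.map (T.d i j).hom (A.d 0 (-1)).hom x =
      ι.lTensor _ ((T.d i j).hom.rTensor _ (π.lTensor _ x)) := by
  rw [← lTensor_rTensor_comm, ← LinearMap.lTensor_comp_apply, hc, ← LinearMap.comp_apply,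
    LinearMap.lTensor_comp_rTensor]

/-- In degree `n + 1 ≥ 0` the first index is at most `n + 1`, so this is where the chase starts and
nothing need vanish beforehand. Applying `π` turns the component into a cycle of `T ⊗ N`; for `n =
-1` this uses that `ι` stays injective after tensoring. -/
lemma exists_vanishesFrom_zero (hN : ∀ i j k : ℤ, i = j + 1 → j = k + 1 → Function.Exact
      ((T.d i j).hom.rTensor N) ((T.d j k).hom.rTensor N))
    (hc : ι ∘ₗ π = (A.d 0 (-1)).hom) (hι : Function.Injective ι) (hπ : Function.Surjective π)
    (hπ' : Function.Exact (A.d 1 0).hom π) (hm : Mem (n + 1) (n + 1) 0)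
    {z : Obj T A (n + 1)} (hz : diff T A n z = 0) :
    ∃ w, VanishesFrom (n + 1) (z - diff T A (n + 1) w) := by
  have hcyc : (T.d (n + 1) n).hom.rTensor N (π.lTensor _ (proj T A (n + 1) (n + 1) 0 z)) = 0 := by
    by_cases hn : 0 ≤ n
    · have hker := proj_diff T A (by unfold Mem; omega : Mem n n 0) rfl (zero_add 1).symm z
      rw [hz, map_zero, map_d_d_eq_zero_right T A (by omega), LinearMap.zero_apply,
        add_zero] at hker
      have := congrArg (π.lTensor _) hker
      rw [map_zero, map_add, map_zsmul, ← LinearMap.lTensor_comp_apply,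
        hπ'.linearMap_comp_eq_zero, LinearMap.lTensor_zero, LinearMap.zero_apply, smul_zero,
        add_zero, lTensor_rTensor_comm] at this
      exact this.symm
    · obtain rfl : n = -1 := by unfold Mem at hm; omega
      have hker := proj_diff T A (by decide : Mem (-1) (-1) (-1)) rfl rfl z
      rw [hz, map_zero, proj_of_not T A _ (-1 + 1) _ (by decide),
        proj_of_not T A _ _ (-1 + 1) (by decide), LinearMap.zero_apply, map_zero,
        LinearMap.zero_apply, map_zero, smul_zero, zero_add, zero_add, map_d_d_apply hc] at hker
      exact (injective_iff_map_eq_zero _).1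
        (Module.Flat.lTensor_preserves_injective_linearMap ι hι) _ hker.symm
  obtain ⟨ξ, hξ⟩ := (hN (n + 1 + 1) (n + 1) n rfl rfl _).1 hcyc
  -- The lift `ω` bounds the component only up to the kernel of `π`, that is, up to a boundary of
  -- `A`; `w` corrects this.
  obtain ⟨ω, rfl⟩ := LinearMap.lTensor_surjective _ hπ ξ
  rw [← lTensor_rTensor_comm, ← sub_eq_zero, ← map_sub] at hξ
  obtain ⟨w, hw⟩ := (lTensor_exact _ hπ' hπ _).1 hξ
  refine ⟨incl T A _ (n + 1 + 1) 0 ω - incl T A _ (n + 1) 1 (((sign (n + 1) : ℤˣ) : ℤ) • w),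
    fun i j hij hi => ?_⟩
  obtain rfl : i = n + 1 := by unfold Mem at *; omega
  obtain rfl : j = 0 := by unfold Mem at *; omega
  have h1 : Mem (n + 1 + 1) (n + 1 + 1) 0 := by unfold Mem at *; omega
  have h2 : Mem (n + 1 + 1) (n + 1) 1 := by unfold Mem at *; omega
  rw [map_sub, sub_eq_zero, proj_diff T A hij rfl (zero_add 1).symm,
    map_d_d_eq_zero_right T A (by omega), LinearMap.zero_apply, add_zero,
    map_sub (proj T A _ (n + 1 + 1) 0), map_sub (proj T A _ (n + 1) 1), proj_incl_self _ _ h1,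
    proj_incl_self _ _ h2, proj_incl_of_ne _ _ (by simp), proj_incl_of_ne _ _ (by simp), sub_zero,
    zero_sub, map_neg, map_zsmul, smul_neg, sign_smul_sign_smul, hw]
  simp

/-- In negative degrees the edge carries the smallest first index, so the chase ends here. The
component comes through `ι` from a cycle of `T ⊗ N`, which bounds some `ξ`. -/
lemma exists_vanishesFrom_neg_one (hN : ∀ i j k : ℤ, i = j + 1 → j = k + 1 → Function.Exact
      ((T.d i j).hom.rTensor N) ((T.d j k).hom.rTensor N))
    (hc : ι ∘ₗ π = (A.d 0 (-1)).hom) (hι : Function.Injective ι) (hπ : Function.Surjective π)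
    (hι' : Function.Exact ι (A.d (-1) (-2)).hom) (hm : Mem (n + 1) (n + 1) (-1))
    {z : Obj T A (n + 1)} (hz : diff T A n z = 0) (hv : VanishesFrom (n + 1 + 1) z) :
    ∃ w, VanishesFrom (n + 1) (z - diff T A (n + 1) w) := by
  have hinj : ∀ i, Function.Injective (ι.lTensor (T.X i)) := fun i =>
    Module.Flat.lTensor_preserves_injective_linearMap ι hι
  have hker := proj_diff T A (by unfold Mem at *; omega : Mem n (n + 1) (-2)) rfl
    (by omega : (-1 : ℤ) = -2 + 1) z
  rw [hz, map_zero, hv.proj_eq_zero le_rfl, map_zero, zero_add,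
    map_d_d_eq_zero_right T A (by omega), LinearMap.zero_apply, add_zero] at hker
  obtain ⟨ζ, hζ⟩ := (Module.Flat.lTensor_exact _ hι' _).1 (eq_zero_of_sign_smul hker.symm)
  have hcyc : (T.d (n + 1) n).hom.rTensor N ζ = 0 := by
    have hker' := proj_diff T A (by unfold Mem at *; omega : Mem n n (-1)) rfl rfl z
    rw [hz, map_zero, map_d_d_eq_zero_left T A (by unfold Mem at hm; omega),
      proj_of_not T A _ _ (-1 + 1) (by unfold Mem at *; omega), LinearMap.zero_apply,
      LinearMap.zero_apply, map_zero, smul_zero, add_zero, add_zero, ← hζ,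
      ← lTensor_rTensor_comm] at hker'
    exact (injective_iff_map_eq_zero _).1 (hinj _) _ hker'.symm
  obtain ⟨ξ, rfl⟩ := (hN (n + 1 + 1) (n + 1) n rfl rfl _).1 hcyc
  -- In degree `-1` the preimage must lie in `T_0 ⊗ A_0`, so `ξ` is lifted along `π`. Lower down `ι`
  -- pushes it into `A_{-1}`, and `∂ι = 0` spoils no other component.
  by_cases hn : n + 1 = -1
  · obtain rfl : n = -2 := by omega
    obtain ⟨ω, rfl⟩ := LinearMap.lTensor_surjective _ hπ ξ
    refine ⟨incl T A _ 0 0 ω, fun i j hij hi => ?_⟩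
    obtain rfl : i = -2 + 1 := by unfold Mem at hij; omega
    obtain rfl : j = -1 := by unfold Mem at hij; omega
    rw [map_sub, sub_eq_zero, proj_diff T A hij rfl rfl, proj_incl_of_ne _ _ (by simp),
      proj_incl_of_ne _ _ (by simp), proj_incl_self _ _ (by decide), map_zero, map_zero,
      smul_zero, zero_add, zero_add, ← hζ]
    exact (map_d_d_apply hc _ _ _).symm
  · have h1 : Mem (n + 1 + 1) (n + 1 + 1) (-1) := by unfold Mem at *; omega
    refine ⟨incl T A _ (n + 1 + 1) (-1) (ι.lTensor _ ξ), fun i j hij hi => ?_⟩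
    rw [map_sub, sub_eq_zero, proj_diff T A hij rfl rfl,
      proj_incl_of_ne (i' := 0) _ _ (by simp), map_zero, add_zero]
    rcases hi.eq_or_lt with rfl | hi
    · obtain rfl : j = -1 := by unfold Mem at *; omega
      rw [proj_incl_self _ _ h1, proj_incl_of_ne _ _ (by simp), map_zero, smul_zero, add_zero,
        ← hζ, lTensor_rTensor_comm]
    · rw [hv.proj_eq_zero (by omega), proj_incl_of_ne _ _ (by simp; omega), map_zero, zero_add]
      by_cases hij' : (i, j + 1) = (n + 1 + 1, -1)
      · obtain ⟨rfl, hj⟩ := Prod.mk.inj hij'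
        obtain rfl : j = -2 := by omega
        have h2 : (A.d (-1) (-2)).hom.lTensor (T.X (n + 1 + 1)) (ι.lTensor _ ξ) = 0 := by
          rw [← LinearMap.lTensor_comp_apply, hι'.linearMap_comp_eq_zero, LinearMap.lTensor_zero,
            LinearMap.zero_apply]
        exact ((congrArg _ (congrArg _ (proj_incl_self T A h1 _))).trans
          (congrArg _ h2)).trans (smul_zero _) |>.symm
      · rw [proj_incl_of_ne _ _ hij', map_zero, smul_zero]

lemma exists_diff_eq (hA : A.Acyclic)
    (hN : ∀ i j k : ℤ, i = j + 1 → j = k + 1 → Function.Exact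
      ((T.d i j).hom.rTensor N) ((T.d j k).hom.rTensor N))
    (hc : ι ∘ₗ π = (A.d 0 (-1)).hom) (hι : Function.Injective ι) (hπ : Function.Surjective π)
    (hπ' : Function.Exact (A.d 1 0).hom π) (hι' : Function.Exact ι (A.d (-1) (-2)).hom)
    (z : Obj T A (n + 1)) (hz : diff T A n z = 0) : ∃ w, diff T A (n + 1) w = z := by
  -- Descending induction on the first index, shifted by `|n| + 1` to be a natural number: every
  -- index in degree `n + 1` is at least `-(|n| + 1)` and below `|n| + 2`.
  suffices ∀ (b : ℕ) (z : Obj T A (n + 1)), diff T A n z = 0 →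
      VanishesFrom (b - (n.natAbs + 1 : ℕ)) z → ∃ w, diff T A (n + 1) w = z by
    refine this (n.natAbs + 1 + n.natAbs + 2) z hz fun i j hij hi => ?_
    unfold Mem at hij
    omega
  intro b
  induction b with
  | zero =>
    intro z _ hv
    refine ⟨0, ?_⟩
    rw [map_zero]
    refine (eq_zero_of_proj z fun i j hij => hv i j hij ?_).symm
    unfold Mem at hij
    omega
  | succ b ih =>
    intro z hz hv
    set k : ℤ := b - (n.natAbs + 1 : ℕ) with hk
    replace hv : VanishesFrom (k + 1) z := by
      rwa [show k + 1 = ((b + 1 : ℕ) : ℤ) - (n.natAbs + 1 : ℕ) by omega]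
    suffices ∃ w, VanishesFrom k (z - diff T A (n + 1) w) by
      obtain ⟨w, hw⟩ := this
      obtain ⟨w', hw'⟩ := ih (z - diff T A (n + 1) w)
        (by
        rw [map_sub, hz, ← LinearMap.comp_apply, diff_comp_diff, LinearMap.zero_apply, sub_zero]) hw
      exact ⟨w' + w, by rw [map_add, hw', sub_add_cancel]⟩
    by_cases hm : ∃ l, Mem (n + 1) k l
    · obtain ⟨l, hm⟩ := hm
      by_cases h0 : l = 0
      · obtain rfl := h0
        obtain hkn : k = n + 1 := by unfold Mem at hm; omega
        rw [hkn] at hm ⊢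
        exact exists_vanishesFrom_zero hN hc hι hπ hπ' hm hz
      by_cases h1 : l = -1
      · obtain rfl := h1
        obtain hkn : k = n + 1 := by unfold Mem at hm; omega
        rw [hkn] at hm hv ⊢
        exact exists_vanishesFrom_neg_one hN hc hι hπ hι' hm hz hv
      exact exists_vanishesFrom_of_ne hA hm h0 h1 hz hv
    · refine ⟨0, fun i j hij hi => ?_⟩
      rw [map_zero, sub_zero]
      rcases hi.eq_or_lt with rfl | hi
      · exact absurd ⟨j, hij⟩ hm
      · exact hv i j hij hi

end Chase

end PinchedTensor

/-! ### Module properties, minimality and the main theorem. -/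

section PinchedComplex

variable {R : Type u} [CommRing R] {T A : ChainComplex (ModuleCat.{u} R) ℤ}

open PinchedTensor

lemma pinchedTensor_d (n : ℤ) :
    (pinchedTensor T A).d (n + 1) n = ModuleCat.ofHom (diff T A n) :=
  ChainComplex.of_d (fun n => ModuleCat.of R (Obj T A n)) (fun n => ModuleCat.ofHom (diff T A n)) n

instance PinchedTensor.finite_idx (n : ℤ) : Finite (Idx n) := by
  refine Set.Finite.subset (Set.toFinite (Set.Icc (-(n.natAbs : ℤ) - 1) n.natAbs ×ˢ
    Set.Icc (-(n.natAbs : ℤ) - 1) n.natAbs)) fun p hp => ?_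
  change Mem n p.1 p.2 at hp
  unfold Mem at hp
  simp only [Set.mem_prod, Set.mem_Icc]
  omega

lemma pinchedTensor_finite (hT : ∀ i, Module.Finite R (T.X i)) (hA : ∀ i, Module.Finite R (A.X i))
    (i : ℤ) : Module.Finite R ((pinchedTensor T A).X i) :=
  inferInstanceAs (Module.Finite R (Π₀ p : Idx i, (T.X p.1.1 ⊗[R] A.X p.1.2)))

lemma pinchedTensor_projective (hT : ∀ i, Module.Projective R (T.X i))
    (hA : ∀ i, Module.Projective R (A.X i)) (i : ℤ) :
    Module.Projective R ((pinchedTensor T A).X i) :=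
  inferInstanceAs (Module.Projective R (⨁ p : Idx i, (T.X p.1.1 ⊗[R] A.X p.1.2)))

lemma pinchedTensor_free (hT : ∀ i, Module.Free R (T.X i))
    (hA : ∀ i, Module.Free R (A.X i)) (i : ℤ) : Module.Free R ((pinchedTensor T A).X i) :=
  inferInstanceAs (Module.Free R (⨁ p : Idx i, (T.X p.1.1 ⊗[R] A.X p.1.2)))

lemma map_mem_smul_top {P Q : Type*} [AddCommGroup P] [Module R P] [AddCommGroup Q] [Module R Q]
    (I : Ideal R) (f : P →ₗ[R] Q) {x : P} (hx : x ∈ I • (⊤ : Submodule R P)) :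
    f x ∈ I • (⊤ : Submodule R Q) :=
  Submodule.smul_top_le_comap_smul_top I f hx

lemma IsMinimalComplex.d_mem [IsLocalRing R] (hT : IsMinimalComplex T) (i j : ℤ) (x : T.X i) :
    (T.d i j).hom x ∈ IsLocalRing.maximalIdeal R • (⊤ : Submodule R (T.X j)) := by
  by_cases h : j + 1 = i
  · obtain rfl := h
    exact hT.range_le j ⟨x, rfl⟩
  · rw [T.shape i j (by simpa using h)]
    exact zero_mem _

lemma IsMinimalComplex.pinchedTensor [IsLocalRing R] (hT : IsMinimalComplex T)
    (hA : IsMinimalComplex A) : IsMinimalComplex (pinchedTensor T A) where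
  free := pinchedTensor_free hT.free hA.free
  finite := pinchedTensor_finite hT.finite hA.finite
  range_le n := by
    rw [pinchedTensor_d]
    rintro _ ⟨z, rfl⟩
    change diff T A n z ∈ IsLocalRing.maximalIdeal R • (⊤ : Submodule R (Obj T A n))
    induction z using DirectSum.induction_on with
    | zero => rw [map_zero]; exact zero_mem _
    | add x y hx hy => rw [map_add]; exact add_mem hx hy
    | of p z =>
      change diff T A n (DirectSum.lof R _ _ p z) ∈ _
      rw [diff, DirectSum.toModule_lof]
      -- This serves both `∂x ⊗ y` and the gluing term `∂x ⊗ ∂y`.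
      have hleft (i j : ℤ) (x : T.X p.1.1) (y : A.X j) : (T.d p.1.1 i).hom x ⊗ₜ[R] y ∈
          IsLocalRing.maximalIdeal R • (⊤ : Submodule R (T.X i ⊗[R] A.X j)) :=
        map_mem_smul_top _ ((TensorProduct.mk R _ _).flip y) (hT.d_mem _ _ x)
      induction z with
      | zero => rw [map_zero]; exact zero_mem _
      | add x y hx hy => rw [map_add]; exact add_mem hx hy
      | tmul x y =>
        refine add_mem (add_mem ?_ ?_) ?_
        · exact map_mem_smul_top _ (incl T A _ _ _) (hleft _ _ x y)
        · exact zsmul_mem (map_mem_smul_top _ (incl T A _ _ _)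
            (map_mem_smul_top _ (TensorProduct.mk R _ _ x) (hA.d_mem _ _ y))) _
        · exact map_mem_smul_top _ (incl T A _ _ _) (hleft _ _ x _)

section Resolutions

variable {M N : Type u} [AddCommGroup M] [Module R M] [AddCommGroup N] [Module R N]

/-- The augmentation `T_0 → M` and the coaugmentation `M → T_{-1}` of a complete resolution. -/
lemma IsCompleteResolution.exists_factorization (hT : IsCompleteResolution T M) :
    ∃ (π : T.X 0 →ₗ[R] M) (ι : M →ₗ[R] T.X (-1)), ι ∘ₗ π = (T.d 0 (-1)).hom ∧
      Function.Injective ι ∧ Function.Surjective π ∧ Function.Exact (T.d 1 0).hom π ∧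
      Function.Exact ι (T.d (-1) (-2)).hom := by
  obtain ⟨e⟩ := hT.coker_equiv
  have hex := exact_of_exactAt T (zero_add 1).symm (by omega : (0 : ℤ) = -1 + 1)
    (hT.totallyAcyclic.acyclic 0)
  have hex' := exact_of_exactAt T (by omega : (0 : ℤ) = -1 + 1) (by omega : (-1 : ℤ) = -2 + 1)
    (hT.totallyAcyclic.acyclic (-1))
  have hπ : Function.Surjective (e.toLinearMap ∘ₗ (LinearMap.range (T.d 1 0).hom).mkQ) :=
    e.surjective.comp (Submodule.mkQ_surjective _)
  have hc : (cokerDesc T 1 0 (-1) ∘ₗ e.symm.toLinearMap) ∘ₗ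
      (e.toLinearMap ∘ₗ (LinearMap.range (T.d 1 0).hom).mkQ) = (T.d 0 (-1)).hom := by
    ext x
    simp [cokerDesc]
  refine ⟨_, _, hc, (cokerDesc_injective hex).comp e.symm.injective, hπ, ?_, ?_⟩
  · rw [LinearMap.exact_iff, LinearMap.ker_comp, LinearEquiv.ker, Submodule.comap_bot,
      Submodule.ker_mkQ]
  · rw [LinearMap.exact_iff, hex'.linearMap_ker_eq, ← hc, LinearMap.range_comp_of_range_eq_top]
    exact LinearMap.range_eq_top.2 hπ

lemma rTensor_exact_of_tateHomology (h : ∀ i, Limits.IsZero (tateHomology T N i)) (i j k : ℤ)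
    (hij : i = j + 1) (hjk : j = k + 1) :
    Function.Exact ((T.d i j).hom.rTensor N) ((T.d j k).hom.rTensor N) :=
  exact_of_exactAt (((MonoidalCategory.tensorRight (ModuleCat.of R N)).mapHomologicalComplex
    _).obj T) hij hjk ((HomologicalComplex.exactAt_iff_isZero_homology _ _).2 (h j))

lemma pinchedTensor_acyclic (hT : ∀ i, Module.Projective R (T.X i))
    (hA : IsCompleteResolution A N) (h : ∀ i, Limits.IsZero (tateHomology T N i)) :
    (pinchedTensor T A).Acyclic := by
  obtain ⟨π, ι, hc, hι, hπ, hπ', hι'⟩ := hA.exists_factorization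
  intro m
  obtain ⟨n, rfl⟩ : ∃ n, m = n + 1 := ⟨m - 1, by omega⟩
  refine exactAt_of_exact _ rfl rfl ?_
  rw [pinchedTensor_d, pinchedTensor_d]
  intro z
  refine ⟨fun hz => exists_diff_eq hA.totallyAcyclic.acyclic (rTensor_exact_of_tateHomology h)
    hc hι hπ hπ' hι' z hz, ?_⟩
  rintro ⟨w, rfl⟩
  exact LinearMap.congr_fun (diff_comp_diff T A n) w

/-- The cokernel of the pinched tensor product in degree zero is the tensor product of the
cokernels. -/
lemma pinchedTensor_coker {π : T.X 0 →ₗ[R] M} (hπ : Function.Surjective π)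
    (hexπ : Function.Exact (T.d 1 0).hom π) {ρ : A.X 0 →ₗ[R] N} (hρ : Function.Surjective ρ)
    (hexρ : Function.Exact (A.d 1 0).hom ρ) :
    Nonempty (((pinchedTensor T A).X 0 ⧸ LinearMap.range ((pinchedTensor T A).d 1 0).hom)
      ≃ₗ[R] M ⊗[R] N) := by
  have hm : Mem 0 0 0 := by decide
  have hd (z : Obj T A (0 + 1)) : proj T A 0 0 0 (diff T A 0 z) =
      (T.d 1 0).hom.rTensor _ (proj T A (0 + 1) 1 0 z) +
        ((sign 0 : ℤˣ) : ℤ) • (A.d 1 0).hom.lTensor _ (proj T A (0 + 1) 0 1 z) := by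
    rw [proj_diff T A hm (zero_add 1).symm (zero_add 1).symm,
      map_d_d_eq_zero_left T A (by omega), LinearMap.zero_apply, add_zero]
  -- Right exactness: the kernel of `π ⊗ ρ` is the sum of the images from bidegrees `(1, 0)` and
  -- `(0, 1)`, which is all of degree one.
  have hker := TensorProduct.map_ker hexπ hπ hexρ hρ
  let φ : Obj T A 0 →ₗ[R] M ⊗[R] N := TensorProduct.map π ρ ∘ₗ proj T A 0 0 0
  have hφ : Function.Surjective φ := (TensorProduct.map_surjective hπ hρ).comp
    fun x => ⟨incl T A 0 0 0 x, proj_incl_self T A hm x⟩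
  have heq : LinearMap.range (diff T A 0) = LinearMap.ker φ := by
    ext z
    rw [LinearMap.ker_comp, hker, Submodule.mem_comap, Submodule.mem_sup]
    constructor
    · rintro ⟨w, rfl⟩
      exact ⟨_, zsmul_mem (LinearMap.mem_range_self _ _) _, _, LinearMap.mem_range_self _ _,
        (add_comm _ _).trans (hd w).symm⟩
    · rintro ⟨_, ⟨a, rfl⟩, _, ⟨b, rfl⟩, hab⟩
      refine ⟨incl T A _ 0 1 (((sign 0 : ℤˣ) : ℤ) • a) + incl T A _ 1 0 b, ?_⟩
      rw [← sub_eq_zero]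
      refine eq_zero_of_proj _ fun i j hij => ?_
      obtain rfl : i = 0 := by unfold Mem at hij; omega
      obtain rfl : j = 0 := by unfold Mem at hij; omega
      rw [map_sub, hd, map_add (proj T A (0 + 1) 1 0), map_add (proj T A (0 + 1) 0 1),
        proj_incl_self T A (by decide : Mem (0 + 1) 1 0),
        proj_incl_self T A (by decide : Mem (0 + 1) 0 1), proj_incl_of_ne _ _ (by simp),
        proj_incl_of_ne _ _ (by simp), zero_add, add_zero, map_zsmul, sign_smul_sign_smul, ← hab,
        add_comm, sub_self]
  have hd' : (pinchedTensor T A).d 1 0 = ModuleCat.ofHom (diff T A 0) := pinchedTensor_d 0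
  rw [hd']
  exact ⟨(Submodule.quotEquivOfEq _ _ heq).trans (φ.quotKerEquivOfSurjective hφ)⟩

variable [IsLocalRing R] [IsNoetherianRing R]

/-- Over a Gorenstein ring, a finitely generated module with a complete resolution is totally
reflexive. -/
lemma IsCompleteResolution.isTotallyReflexive (hR : IsGorensteinLocal R)
    (hT : IsCompleteResolution T M) (hM : Module.Finite R M) : IsTotallyReflexive R M := by
  refine IsExtFree.isTotallyReflexive hR ⟨hM, fun i hi => ?_⟩
  obtain ⟨n, hn⟩ := hR
  obtain ⟨π, ι, hc, hι, hπ, -, -⟩ := hT.exists_factorization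
  have := hT.totallyAcyclic.projective (-1)
  -- `M` is a syzygy of the cokernel of `T_0 → T_{-1}`, whose higher `Ext` into `R` vanishes.
  refine subsingleton_ext_of_succ (g := (LinearMap.range (T.d 0 (-1)).hom).mkQ) hι ?_
    (Submodule.mkQ_surjective _) _ i hi
    (subsingleton_ext_cokerD hT.totallyAcyclic.acyclic hT.totallyAcyclic.projective _ n (i + 1)
      (by omega) 0 (-1) (by omega))
  rw [LinearMap.exact_iff, Submodule.ker_mkQ, ← hc, LinearMap.range_comp_of_range_eq_top]
  exact LinearMap.range_eq_top.2 hπ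

end Resolutions

end PinchedComplex

theorem mainTheorem8 {R : Type u} [CommRing R] [IsLocalRing R] [IsNoetherianRing R]
    (hR : IsGorensteinLocal R)
    (M N : Type u) [AddCommGroup M] [Module R M] [AddCommGroup N] [Module R N]
    (hM : IsTotallyReflexive R M) (hN : IsTotallyReflexive R N)
    (T T' : ChainComplex (ModuleCat.{u} R) ℤ)
    (hT : IsCompleteResolution T M) (hT' : IsCompleteResolution T' N)
    (hTor : ∀ i : ℤ, Limits.IsZero (tateHomology T N i)) :
    IsTotallyReflexive R (M ⊗[R] N) ∧
    IsCompleteResolution (pinchedTensor T T') (M ⊗[R] N) ∧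
    ((∀ i : ℤ, Module.Finite R (T.X i)) → (∀ i : ℤ, Module.Finite R (T'.X i)) →
      ∀ i : ℤ, Module.Finite R ((pinchedTensor T T').X i)) ∧
    (IsMinimalComplex T → IsMinimalComplex T' → IsMinimalComplex (pinchedTensor T T')) := by
  obtain ⟨π, -, -, -, hπ, hexπ, -⟩ := hT.exists_factorization
  obtain ⟨ρ, -, -, -, hρ, hexρ, -⟩ := hT'.exists_factorization
  have hres : IsCompleteResolution (pinchedTensor T T') (M ⊗[R] N) :=
    ⟨hR.isTotallyAcyclic (pinchedTensor_acyclic hT.totallyAcyclic.projective hT' hTor)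
      (pinchedTensor_projective hT.totallyAcyclic.projective hT'.totallyAcyclic.projective),
      pinchedTensor_coker hπ hexπ hρ hexρ⟩
  have := hM.finite
  have := hN.finite
  exact ⟨hres.isTotallyReflexive hR inferInstance, hres, pinchedTensor_finite,
    IsMinimalComplex.pinchedTensor⟩
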